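/- Let $\tau, z \in \mathbb{C}$ with $\operatorname{Im}\tau > 0$, and put $q = e^{2\pi i \tau}$, $x = e^{2\pi i z}$. For $|p|<1$ write $(a;p) := \prod_{k\ge 0}(1-ap^k)$, and for $a \ne 0$ write $\langle a;p\rangle := (a;p)(p/a;p)$. For $k\in\{0,1\}$ let \[ [qx^2;k] := \sum_{n\in\mathbb{Z}} q^n q^{2\binom n2 + kn} x^{2n+k} = \sum_{n\in\mathbb{Z}} q^{n^2+kn}x^{2n+k}. \] Then all the series over $n \in \mathbb{Z}$ above and below converge absolutely, and \[ \begin{pmatrix} \sum_{n\in\mathbb{Z}} q^{n^2}x^{2n}\,(q^{n+1}x;q)\\[2pt] \sum_{n\in\mathbb{Z}} q^{n^2+n}x^{2n+1}\,(q^{n+1}x;q) \end{pmatrix} = \begin{pmatrix} A(q) & B(q)\\ C(q) & D(q)\end{pmatrix} \begin{pmatrix} [qx^2;0]\\ [qx^2;1]\end{pmatrix}, \] where \[ \begin{pmatrix} A(q) & B(q)\\ C(q) & D(q)\end{pmatrix} = \frac{(q^{10};q^{10})}{(q;q)} \begin{pmatrix} \langle q;q^{10}\rangle\langle q^8;q^{20}\rangle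 & -q\,\langle q^4;q^{10}\rangle\langle q^2;q^{20}\rangle\\[2pt] -\langle q^3;q^{10}\rangle\langle q^4;q^{20}\rangle & \langle q^2;q^{10}\rangle\langle q^6;q^{20}\rangle \end{pmatrix}. \] -/

import Mathlib

open Complex Matrix

noncomputable section

/-- The infinite `q`-Pochhammer symbol `(a; q) = ∏_{k ≥ 0} (1 - a q ^ k)`, meant for `‖q‖ < 1`. -/
def qPoch (a q : ℂ) : ℂ := ∏' k : ℕ, (1 - a * q ^ k)

/-- For `‖q‖ < 1` the product defining `(a; q)` converges. -/
theorem multipliable_qPoch (a : ℂ) {q : ℂ} (hq : ‖q‖ < 1) :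
    Multipliable fun k : ℕ => 1 - a * q ^ k := by
  have h : Summable fun k : ℕ => -(a * q ^ k) :=
    ((summable_geometric_of_norm_lt_one hq).mul_left a).neg
  simpa [sub_eq_add_neg] using multipliable_one_add_of_summable h.norm

/-- For `‖q‖ < 1`, `(a; q)` is the limit of `(a; q)_n = ∏_{k < n} (1 - a q ^ k)`. -/
theorem tendsto_qPoch (a : ℂ) {q : ℂ} (hq : ‖q‖ < 1) :
    Filter.Tendsto (fun n : ℕ => ∏ k ∈ Finset.range n, (1 - a * q ^ k)) Filter.atTop
      (nhds (qPoch a q)) :=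
  (multipliable_qPoch a hq).tendsto_prod_tprod_nat

/-- The modified theta function `⟨a; q⟩ = (a; q) (q / a; q)`, for `a ≠ 0`. -/
def qTheta (a q : ℂ) : ℂ := qPoch a q * qPoch (q / a) q

/-- The `n`-th term `α ^ n q ^ (d * binom(n, 2) + k n) x ^ (d n + k)` of the canonical vector
`[α x ^ d; k]`. The integer division by `2` is exact. -/
def canonicalTerm (q x α : ℂ) (d k n : ℤ) : ℂ :=
  α ^ n * q ^ (d * (n * (n - 1) / 2) + k * n) * x ^ (d * n + k)

/-- The canonical basis vector `[α x ^ d; k] = ∑_{n ∈ ℤ} α ^ n q ^ (d * binom(n, 2) + k n) x ^ (d n + k)`. -/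
def canonicalVec (q x α : ℂ) (d k : ℤ) : ℂ := ∑' n : ℤ, canonicalTerm q x α d k n

/-- The matrix with entries `A(q)`, `B(q)`, `C(q)`, `D(q)`. -/
def rogRamMatrix (q : ℂ) : Matrix (Fin 2) (Fin 2) ℂ :=
  (qPoch (q ^ 10) (q ^ 10) / qPoch q q) •
    !![qTheta q (q ^ 10) * qTheta (q ^ 8) (q ^ 20),
       -(q * qTheta (q ^ 4) (q ^ 10) * qTheta (q ^ 2) (q ^ 20));
       -(qTheta (q ^ 3) (q ^ 10) * qTheta (q ^ 4) (q ^ 20)),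
       qTheta (q ^ 2) (q ^ 10) * qTheta (q ^ 6) (q ^ 20)]

end

noncomputable section

/-! ### Summability of Gaussian-type series -/

/-! Expanding `(q^(n+1) x; q)` by Euler and splitting the Euler index as `2j` or `2j + 1`, the shift
`n ↦ n - j` separates the variables: each row becomes a combination of canonical vectors whose
coefficients, up to sign and a power of `q`, are `∑ q^(j²+cj)/(q;q)_{2j}` and `∑
q^(j²+cj)/(q;q)_{2j+1}` (`tsum_mul_qPoch_expansion`). It remains to evaluate four Rogers series
modulo 20.

This is a Bailey-type argument. Finite identities write `1/(q;q)_{2n}` and `1/(q;q)_{2n+1}`,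
possibly times `q^n`, as differences of sums of `q^(6r²+br)/((q;q)_{k-3r} (q;q)_{l+3r})`. Weighting
by `q^(n²+εn)` and summing over `n` first, Cauchy's identity `tsum_durfeeTerm` turns every inner sum
into `1/(q;q)` and adds `9r²` to the exponent. The resulting pair of theta series in `15r²` is the
quintuple product in base `q^10` at `z = q^m`, with `m = 1, 2, 3, 4` giving the four entries.

Reciprocal factorials vanish at negative indices, so all sums run over `ℤ` and index shifts cost
nothing. -/

theorem summable_exp_neg_sq_add (a b : ℝ) (ha : 0 < a) :
    Summable fun n : ℤ => Real.exp (-a * n ^ 2 + b * n) := by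
  -- With `τ = (a/π) i` and `z = -(b/2π) i`, the theta term has norm `exp(-a n² + b n)`.
  have h := ((summable_jacobiTheta₂_term_iff (((-b / (2 * Real.pi) : ℝ) : ℂ) * I)
    (((a / Real.pi : ℝ) : ℂ) * I)).2 (by simpa using div_pos ha Real.pi_pos)).norm
  refine h.congr fun n => ?_
  rw [norm_jacobiTheta₂_term]
  congr 1
  simp only [mul_im, ofReal_re, I_im, ofReal_im, I_re]
  field_simp
  ring

/-- The norm is the exponential of a quadratic in `n` with leading coefficient `A log ‖q‖ < 0`. Real
`A`, `B`, `C` allow for triangular exponents. -/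
theorem summable_norm_zpow_mul_zpow {q x : ℂ} (hq0 : q ≠ 0) (hq1 : ‖q‖ < 1) (hx : x ≠ 0)
    {e : ℤ → ℤ} {A B C : ℝ} (hA : 0 < A) (he : ∀ n, (e n : ℝ) = A * n ^ 2 + B * n + C) (u v : ℤ) :
    Summable fun n : ℤ => ‖q ^ e n * x ^ (u * n + v)‖ := by
  have hq : 0 < ‖q‖ := norm_pos_iff.2 hq0
  have hx' : 0 < ‖x‖ := norm_pos_iff.2 hx
  have hlog : Real.log ‖q‖ < 0 := Real.log_neg hq hq1
  have h := (summable_exp_neg_sq_add (-(A * Real.log ‖q‖))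
    (B * Real.log ‖q‖ + u * Real.log ‖x‖) (by nlinarith)).mul_right
    (Real.exp (C * Real.log ‖q‖ + v * Real.log ‖x‖))
  refine h.congr fun n => ?_
  rw [norm_mul, norm_zpow, norm_zpow, ← Real.rpow_intCast, ← Real.rpow_intCast,
    Real.rpow_def_of_pos hq, Real.rpow_def_of_pos hx', ← Real.exp_add, ← Real.exp_add, he]
  congr 1
  push_cast
  ring

theorem summable_norm_zpow {q : ℂ} (hq0 : q ≠ 0) (hq1 : ‖q‖ < 1)
    {e : ℤ → ℤ} {A B C : ℝ} (hA : 0 < A) (he : ∀ n, (e n : ℝ) = A * n ^ 2 + B * n + C) :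
    Summable fun n : ℤ => ‖q ^ e n‖ := by
  simpa using summable_norm_zpow_mul_zpow hq0 hq1 one_ne_zero hA he 0 0

theorem Summable.norm_mul_of_norm_le {ι : Type*} {f g : ι → ℂ} (hf : Summable fun i => ‖f i‖)
    {K : ℝ} (hg : ∀ i, ‖g i‖ ≤ K) : Summable fun i => ‖f i * g i‖ := by
  refine Summable.of_nonneg_of_le (fun _ => norm_nonneg _) (fun i => ?_) (hf.mul_right K)
  rw [norm_mul]
  gcongr
  exact hg i

/-- The triangular number `n (n - 1) / 2`. -/
def triangular (n : ℤ) : ℤ := n * (n - 1) / 2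

theorem two_mul_triangular (n : ℤ) : 2 * triangular n = n * (n - 1) :=
  Int.mul_ediv_cancel' (Int.even_mul_pred_self n).two_dvd

theorem triangular_cast (n : ℤ) : (triangular n : ℝ) = 1 / 2 * n ^ 2 + (-1 / 2) * n + 0 := by
  have h : (2 : ℝ) * triangular n = n * (n - 1) := by exact_mod_cast two_mul_triangular n
  linarith

theorem triangular_succ (n : ℤ) : triangular (n + 1) = triangular n + n := by
  linarith [two_mul_triangular n, two_mul_triangular (n + 1)]

theorem triangular_zero : triangular 0 = 0 := rfl

/-- A series over `ℤ` may be summed along residue classes. -/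
theorem tsum_int_eq_sum_tsum_mod (m : ℕ) [NeZero m] {f : ℤ → ℂ} (hf : Summable f) :
    ∑' n, f n = ∑ i : Fin m, ∑' k : ℤ, f (m * k + (i : ℕ)) := by
  have hs := (Int.divModEquiv m).symm.summable_iff.2 hf
  rw [← (Int.divModEquiv m).symm.tsum_eq f]
  change ∑' c, (f ∘ (Int.divModEquiv m).symm) c = _
  rw [hs.tsum_prod]
  simp only [Function.comp_apply]
  simp only [tsum_fintype, Int.divModEquiv_symm_apply, mul_comm]
  refine Summable.tsum_finsetSum fun i _ => ?_
  exact (hs.prod_symm.prod_factor i).congr fun k => by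
    simp [Int.divModEquiv_symm_apply]

/-! ### The shifted factorial and its reciprocal -/

theorem norm_mul_pow_lt_one {q : ℂ} (hq1 : ‖q‖ < 1) (k : ℕ) : ‖q * q ^ k‖ < 1 := by
  rw [← pow_succ', norm_pow]
  exact pow_lt_one₀ (norm_nonneg _) hq1 k.succ_ne_zero

theorem qPoch_ne_zero_of_forall {a q : ℂ} (hq1 : ‖q‖ < 1) (h : ∀ k : ℕ, a * q ^ k ≠ 1) :
    qPoch a q ≠ 0 := by
  have hs : Summable fun k : ℕ => -(a * q ^ k) :=
    ((summable_geometric_of_norm_lt_one hq1).mul_left a).neg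
  have := tprod_one_add_ne_zero_of_summable (f := fun k : ℕ => -(a * q ^ k))
    (fun k hk => h k (by linear_combination -hk)) hs.norm
  simpa [qPoch, sub_eq_add_neg] using this

theorem qPoch_self_ne_zero {q : ℂ} (hq1 : ‖q‖ < 1) : qPoch q q ≠ 0 :=
  qPoch_ne_zero_of_forall hq1 fun k hk => by simpa [hk] using norm_mul_pow_lt_one hq1 k

theorem qPoch_eq_mul {q : ℂ} (hq1 : ‖q‖ < 1) (a : ℂ) :
    qPoch a q = (1 - a) * qPoch (a * q) q := by
  have h := tprod_eq_zero_mul' (f := fun k : ℕ => 1 - a * q ^ k) (by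
    simpa [pow_succ', mul_assoc] using multipliable_qPoch (a * q) hq1)
  simpa [qPoch, pow_succ', mul_assoc] using h

theorem qPoch_one {q : ℂ} (hq1 : ‖q‖ < 1) : qPoch 1 q = 0 := by
  rw [qPoch_eq_mul hq1]; simp

/-- The reciprocal `1 / (q; q)_m`, extended by zero to negative `m`. -/
def qFactInv (q : ℂ) (m : ℤ) : ℂ := qPoch (q ^ (m + 1)) q / qPoch q q

theorem qFactInv_pred {q : ℂ} (hq0 : q ≠ 0) (hq1 : ‖q‖ < 1) (m : ℤ) :
    qFactInv q (m - 1) = (1 - q ^ m) * qFactInv q m := by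
  rw [qFactInv, qFactInv, sub_add_cancel, qPoch_eq_mul hq1, zpow_add_one₀ hq0, mul_div_assoc]

theorem qFactInv_zero {q : ℂ} (hq1 : ‖q‖ < 1) : qFactInv q 0 = 1 := by
  simp [qFactInv, qPoch_self_ne_zero hq1]

/-- At `m = -1` the numerator `(1; q)` contains the factor `1 - 1`; the recurrence carries the zero
downwards. -/
theorem qFactInv_of_neg {q : ℂ} (hq0 : q ≠ 0) (hq1 : ‖q‖ < 1) {m : ℤ} (hm : m < 0) :
    qFactInv q m = 0 := by
  induction m, (show m ≤ -1 by omega) using Int.leInductionDown with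
  | base => simp [qFactInv, qPoch_one hq1]
  | pred n hn ih => rw [qFactInv_pred hq0 hq1, ih (by omega), mul_zero]

theorem qFactInv_natCast_mul_prod {q : ℂ} (hq0 : q ≠ 0) (hq1 : ‖q‖ < 1) (n : ℕ) :
    qFactInv q n * ∏ k ∈ Finset.range n, (1 - q * q ^ k) = 1 := by
  induction n with
  | zero => simp [qFactInv_zero hq1]
  | succ n ih =>
    have h := qFactInv_pred hq0 hq1 ((n : ℤ) + 1)
    rw [add_sub_cancel_right] at h
    have h2 : q ^ ((n : ℤ) + 1) = q * q ^ n := by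
      rw [zpow_add_one₀ hq0, zpow_natCast, mul_comm]
    rw [h, h2] at ih
    rw [Finset.prod_range_succ, Nat.cast_succ]
    linear_combination ih

theorem tendsto_qFactInv {q : ℂ} (hq0 : q ≠ 0) (hq1 : ‖q‖ < 1) :
    Filter.Tendsto (fun n : ℕ => qFactInv q n) Filter.atTop (nhds (qPoch q q)⁻¹) := by
  refine ((tendsto_qPoch q hq1).inv₀ (qPoch_self_ne_zero hq1)).congr fun n => ?_
  exact (eq_inv_of_mul_eq_one_left (qFactInv_natCast_mul_prod hq0 hq1 n)).symm

theorem exists_norm_qFactInv_le {q : ℂ} (hq0 : q ≠ 0) (hq1 : ‖q‖ < 1) :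
    ∃ K : ℝ, 0 ≤ K ∧ ∀ m, ‖qFactInv q m‖ ≤ K := by
  obtain ⟨K, hK⟩ := (tendsto_qFactInv hq0 hq1).norm.bddAbove_range
  have hK' : ∀ n : ℕ, ‖qFactInv q n‖ ≤ K := fun n => hK ⟨n, rfl⟩
  have h0 : 0 ≤ K := (norm_nonneg _).trans (hK' 0)
  refine ⟨K, h0, fun m => ?_⟩
  rcases lt_or_ge m 0 with hm | hm
  · simpa [qFactInv_of_neg hq0 hq1 hm] using h0
  · lift m to ℕ using hm
    exact hK' m

theorem exists_norm_qFactInv_mul_le {q : ℂ} (hq0 : q ≠ 0) (hq1 : ‖q‖ < 1) :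
    ∃ K : ℝ, 0 ≤ K ∧ ∀ k l, ‖qFactInv q k * qFactInv q l‖ ≤ K := by
  obtain ⟨K, h0, hK⟩ := exists_norm_qFactInv_le hq0 hq1
  refine ⟨K * K, by positivity, fun k l => ?_⟩
  rw [norm_mul]
  exact mul_le_mul (hK k) (hK l) (norm_nonneg _) h0

/-! ### Euler's expansion -/

/-- The `m`-th term of Euler's expansion of `(a; q)`. -/
def eulerTerm (q a : ℂ) (m : ℤ) : ℂ := (-1) ^ m * (q ^ triangular m * a ^ m) * qFactInv q m

theorem summable_norm_eulerTerm {q a : ℂ} (hq0 : q ≠ 0) (hq1 : ‖q‖ < 1) (ha : a ≠ 0) :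
    Summable fun m : ℤ => ‖eulerTerm q a m‖ := by
  obtain ⟨K, -, hK⟩ := exists_norm_qFactInv_le hq0 hq1
  have h := summable_norm_zpow_mul_zpow hq0 hq1 ha (by norm_num) triangular_cast 1 0
  refine (h.norm_mul_of_norm_le hK).congr fun m => ?_
  simp [eulerTerm]

/-- In the difference of the series at `a` and at `aq`, the factor `1 - q^m` cancels the last factor
of `(q;q)_m`; reindexing leaves `-a` times the series at `aq`. -/
theorem tsum_eulerTerm_eq_mul {q a : ℂ} (hq0 : q ≠ 0) (hq1 : ‖q‖ < 1) (ha : a ≠ 0) :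
    ∑' m, eulerTerm q a m = (1 - a) * ∑' m, eulerTerm q (a * q) m := by
  have h1 := (summable_norm_eulerTerm hq0 hq1 ha).of_norm
  have h2 := (summable_norm_eulerTerm hq0 hq1 (mul_ne_zero ha hq0)).of_norm
  have h3 : ∑' m, eulerTerm q a m - ∑' m, eulerTerm q (a * q) m
      = ∑' m, -a * eulerTerm q (a * q) m := by
    rw [← h1.tsum_sub h2, ← (Equiv.addRight (1 : ℤ)).tsum_eq]
    refine tsum_congr fun m => ?_
    have h := qFactInv_pred hq0 hq1 (m + 1)
    rw [add_sub_cancel_right] at h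
    simp only [Equiv.coe_addRight, eulerTerm, h, mul_zpow, triangular_succ,
      zpow_add₀ hq0, zpow_add₀ ha, zpow_add₀ (show (-1 : ℂ) ≠ 0 by norm_num), zpow_one]
    ring
  rw [tsum_mul_left] at h3
  linear_combination h3

/-- **Euler's identity** `(a; q) = ∑ (-1) ^ m q ^ binom(m, 2) a ^ m / (q; q)_m`. -/
theorem tsum_eulerTerm {q a : ℂ} (hq0 : q ≠ 0) (hq1 : ‖q‖ < 1) (ha : a ≠ 0) :
    ∑' m, eulerTerm q a m = qPoch a q := by
  have hne : ∀ n : ℕ, a * q ^ n ≠ 0 := fun n => mul_ne_zero ha (pow_ne_zero _ hq0)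
  have hprod : ∀ n : ℕ, ∑' m, eulerTerm q a m
      = (∏ k ∈ Finset.range n, (1 - a * q ^ k)) * ∑' m, eulerTerm q (a * q ^ n) m := by
    intro n
    induction n with
    | zero => simp
    | succ n ih =>
      rw [ih, tsum_eulerTerm_eq_mul hq0 hq1 (hne n), Finset.prod_range_succ, pow_succ]
      ring_nf
  -- As `a q^n → 0`, only the term `m = 0` survives.
  have hlim : Filter.Tendsto (fun n : ℕ => ∑' m, eulerTerm q (a * q ^ n) m) Filter.atTop
      (nhds (∑' m : ℤ, if m = 0 then 1 else 0)) := by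
    refine tendsto_tsum_of_dominated_convergence (summable_norm_eulerTerm hq0 hq1 ha)
      (fun m => ?_) (Filter.Eventually.of_forall fun n m => ?_)
    · rcases lt_trichotomy m 0 with hm | rfl | hm
      · simp [eulerTerm, qFactInv_of_neg hq0 hq1 hm, hm.ne]
      · simp [eulerTerm, qFactInv_zero hq1, triangular_zero]
      · lift m to ℕ using hm.le
        have hm0 : m ≠ 0 := by rintro rfl; simp at hm
        have h : Filter.Tendsto (fun n : ℕ => (a * q ^ n) ^ m) Filter.atTop (nhds 0) := by
          have := (((tendsto_pow_atTop_nhds_zero_of_norm_lt_one hq1).const_mul a).pow m)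
          simpa [hm0] using this
        have h' := ((h.const_mul (q ^ triangular m)).const_mul ((-1) ^ m)).mul_const
          (qFactInv q m)
        simpa [eulerTerm, hm0] using h'
    -- Negative powers of `a q^n` would grow with `n`; domination by the series at `a` relies on
    -- those terms being zero.
    · rcases lt_or_ge m 0 with hm | hm
      · simp [eulerTerm, qFactInv_of_neg hq0 hq1 hm]
      · lift m to ℕ using hm
        simp only [eulerTerm, norm_mul, zpow_natCast, norm_pow]
        gcongr
        exact mul_le_of_le_one_right (norm_nonneg _) (pow_le_one₀ (norm_nonneg _) hq1.le)
  have h := (tendsto_qPoch a hq1).mul hlim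
  simp only [← hprod, tsum_ite_eq, mul_one] at h
  exact tendsto_nhds_unique tendsto_const_nhds h

/-! ### The Cauchy–Durfee series and the Jacobi triple product -/

/-- The shear `(n, j) ↦ (n + a j, j)` of `ℤ × ℤ`. -/
def shearEquiv (a : ℤ) : ℤ × ℤ ≃ ℤ × ℤ where
  toFun p := (p.1 + a * p.2, p.2)
  invFun p := (p.1 - a * p.2, p.2)
  left_inv p := by simp
  right_inv p := by simp

theorem summable_shear (a : ℤ) {F : ℤ × ℤ → ℂ} (hF : Summable F) :
    Summable fun p : ℤ × ℤ => F (p.1 + a * p.2, p.2) :=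
  (shearEquiv a).summable_iff.2 hF

theorem tsum_shear (a : ℤ) {F : ℤ × ℤ → ℂ} (hF : Summable F) :
    ∑' p, F p = ∑' n, ∑' j, F (n + a * j, j) := by
  rw [← (shearEquiv a).tsum_eq F]
  exact (summable_shear a hF).tsum_prod

theorem neg_one_zpow_mul_self (j : ℤ) : (-1 : ℂ) ^ j * (-1) ^ j = 1 := by
  rw [← mul_zpow]; simp

/-- The `j`-th term of the Cauchy–Durfee series. -/
def durfeeTerm (q : ℂ) (s j : ℤ) : ℂ :=
  q ^ (j ^ 2 + j * s) * (qFactInv q j * qFactInv q (j + s))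

section

variable {q : ℂ} (hq0 : q ≠ 0) (hq1 : ‖q‖ < 1)
include hq0 hq1

theorem summable_durfeeTerm (s : ℤ) : Summable (durfeeTerm q s) := by
  obtain ⟨K, -, hK⟩ := exists_norm_qFactInv_mul_le hq0 hq1
  exact ((summable_norm_zpow hq0 hq1 (A := 1) (B := s) (C := 0) one_pos
    (e := fun j => j ^ 2 + j * s) fun n => by push_cast; ring).norm_mul_of_norm_le
    fun j => hK j (j + s)).of_norm

/-- After shifting `j` by one in the series at `s + 2`, both sides have the summand `q^(j²+js) (1 -
q^j - q^(j+s+1)) / ((q;q)_j (q;q)_{j+s+1})`. -/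
theorem tsum_durfeeTerm_sub (s : ℤ) :
    ∑' j, durfeeTerm q s j - ∑' j, durfeeTerm q (s + 1) j =
      q ^ (s + 1) * (∑' j, durfeeTerm q (s + 2) j - ∑' j, durfeeTerm q (s + 1) j) := by
  have h0 := summable_durfeeTerm hq0 hq1 s
  have h1 := summable_durfeeTerm hq0 hq1 (s + 1)
  have h2 := summable_durfeeTerm hq0 hq1 (s + 2)
  have h2' := (Equiv.subRight (1 : ℤ)).summable_iff.2 h2
  have e2 := (Equiv.subRight (1 : ℤ)).tsum_eq (durfeeTerm q (s + 2))
  rw [← h0.tsum_sub h1, ← e2, ← Summable.tsum_sub (f := fun j => durfeeTerm q (s + 2) (Equiv.subRight (1 : ℤ) j)) h2' h1,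
    ← tsum_mul_left]
  refine tsum_congr fun j => ?_
  have e1 := qFactInv_pred hq0 hq1 j
  have e3 := qFactInv_pred hq0 hq1 (j + (s + 1))
  rw [show j + (s + 1) - 1 = j + s by ring] at e3
  simp only [durfeeTerm, Equiv.subRight_apply, e1, e3,
    show j - 1 + (s + 2) = j + (s + 1) by ring]
  have a1 : q ^ (j ^ 2 + j * (s + 1)) = q ^ (j ^ 2 + j * s) * q ^ j := by
    rw [← zpow_add₀ hq0]; congr 1; ring
  have a2 : q ^ (s + 1) * q ^ ((j - 1) ^ 2 + (j - 1) * (s + 2)) = q ^ (j ^ 2 + j * s) := by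
    rw [← zpow_add₀ hq0]; congr 1; ring
  have a3 : q ^ (j + (s + 1)) = q ^ j * q ^ (s + 1) := zpow_add₀ hq0 _ _
  rw [mul_sub, ← mul_assoc (q ^ (s + 1)), a2, a1, a3]
  ring

theorem tendsto_tsum_durfeeTerm :
    Filter.Tendsto (fun n : ℕ => ∑' j, durfeeTerm q n j) Filter.atTop
      (nhds (qPoch q q)⁻¹) := by
  obtain ⟨K, hK0, hK⟩ := exists_norm_qFactInv_mul_le hq0 hq1
  have hlim : Filter.Tendsto (fun n : ℕ => ∑' j, durfeeTerm q n j) Filter.atTop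
      (nhds (∑' j : ℤ, if j = 0 then (qPoch q q)⁻¹ else 0)) := by
    have hs : Summable fun j : ℤ => ‖q ^ (j ^ 2)‖ * K :=
      (summable_norm_zpow hq0 hq1 (A := 1) (B := 0) (C := 0) one_pos
        (e := fun j => j ^ 2) fun n => by push_cast; ring).mul_right K
    refine tendsto_tsum_of_dominated_convergence hs
      (fun j => ?_) (Filter.Eventually.of_forall fun n j => ?_)
    · rcases lt_trichotomy j 0 with hj | rfl | hj
      · simp [durfeeTerm, qFactInv_of_neg hq0 hq1 hj, hj.ne]
      · simpa [durfeeTerm, qFactInv_zero hq1] using tendsto_qFactInv hq0 hq1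
      · rw [if_neg hj.ne']
        refine squeeze_zero_norm (a := fun n : ℕ => ‖q ^ (j ^ 2)‖ * ‖q ^ j‖ ^ n * K)
          (fun n => ?_) ?_
        · rw [durfeeTerm, norm_mul, zpow_add₀ hq0, _root_.zpow_mul, zpow_natCast, norm_mul, norm_pow]
          gcongr
          exact hK _ _
        · have h1 : ‖q ^ j‖ < 1 := by
            lift j to ℕ using hj.le
            rw [zpow_natCast, norm_pow]
            exact pow_lt_one₀ (norm_nonneg _) hq1 (by rintro rfl; simp at hj)
          simpa using ((tendsto_pow_atTop_nhds_zero_of_lt_one (norm_nonneg _) h1).const_mul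
            ‖q ^ (j ^ 2)‖).mul_const K
    · rcases lt_or_ge j 0 with hj | hj
      · simpa [durfeeTerm, qFactInv_of_neg hq0 hq1 hj] using
          mul_nonneg (zpow_nonneg (norm_nonneg q) (j ^ 2)) hK0
      · rw [durfeeTerm, norm_mul, zpow_add₀ hq0, _root_.zpow_mul, zpow_natCast, norm_mul, norm_pow]
        have h1 : ‖q ^ j‖ ≤ 1 := by
          lift j to ℕ using hj
          rw [zpow_natCast, norm_pow]
          exact pow_le_one₀ (norm_nonneg _) hq1.le
        gcongr
        · exact mul_le_of_le_one_right (norm_nonneg _) (pow_le_one₀ (norm_nonneg _) h1)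
        · exact hK _ _
  simpa using hlim

/-- **Cauchy's identity** `∑_j q ^ (j ^ 2 + j s) / ((q; q)_j (q; q)_{j + s}) = 1 / (q; q)`. -/
theorem tsum_durfeeTerm (s : ℤ) : ∑' j, durfeeTerm q s j = (qPoch q q)⁻¹ := by
  set D : ℤ → ℂ := fun s => ∑' j, durfeeTerm q s j with hD
  have hrec : ∀ s, D s - D (s + 1) = -q ^ (s + 1) * (D (s + 1) - D (s + 1 + 1)) := fun s => by
    have := tsum_durfeeTerm_sub hq0 hq1 s
    rw [show s + 1 + 1 = s + 2 by ring]
    linear_combination this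
  have hlim : Filter.Tendsto (fun n : ℕ => D n) Filter.atTop (nhds (qPoch q q)⁻¹) :=
    tendsto_tsum_durfeeTerm hq0 hq1
  -- The recurrence multiplies by a factor of norm at most one when going down, so each difference
  -- is bounded by arbitrarily late ones, which tend to zero.
  have hle : ∀ n k : ℕ, ‖D n - D (n + 1)‖ ≤ ‖D ((n + k : ℕ) : ℤ) - D ((n + k + 1 : ℕ) : ℤ)‖ := by
    intro n k
    induction k with
    | zero => simp
    | succ k ih =>
      refine ih.trans ?_
      have h := hrec ((n + k : ℕ) : ℤ)
      push_cast at h ⊢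
      rw [h, norm_mul, norm_neg, ← add_assoc]
      refine mul_le_of_le_one_left (norm_nonneg _) ?_
      rw [show (n : ℤ) + k + 1 = ((n + k + 1 : ℕ) : ℤ) by push_cast; rfl, zpow_natCast, norm_pow]
      exact pow_le_one₀ (norm_nonneg _) hq1.le
  have hzero : ∀ n : ℕ, D n - D (n + 1) = 0 := by
    intro n
    have h1 : Filter.Tendsto (fun k : ℕ => ‖D ((n + k : ℕ) : ℤ) - D ((n + k + 1 : ℕ) : ℤ)‖)
        Filter.atTop (nhds 0) := by
      have ha := hlim.comp (Filter.tendsto_atTop_mono (fun k => Nat.le_add_left k n)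
        Filter.tendsto_id)
      have hb := hlim.comp (Filter.tendsto_atTop_mono
        (fun k => (Nat.le_add_left k n).trans (Nat.le_succ _)) Filter.tendsto_id)
      simpa using (ha.sub hb).norm
    exact norm_le_zero_iff.1 (ge_of_tendsto' h1 (hle n))
  -- The same recurrence propagates the vanishing to negative `s`.
  have hall : ∀ s : ℤ, D s - D (s + 1) = 0 := by
    intro s
    rcases le_total s 0 with hs | hs
    · induction s, hs using Int.leInductionDown with
      | base => simpa using hzero 0
      | pred s hs ih => rw [hrec, sub_add_cancel, ih, mul_zero]
    · lift s to ℕ using hs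
      exact hzero s
  have hconst : ∀ s : ℤ, D s = D 0 := by
    intro s
    induction s using Int.induction_on with
    | zero => rfl
    | succ i ih => rw [← ih]; linear_combination -hall i
    | pred i ih =>
      have := hall (-i - 1)
      rw [sub_add_cancel] at this
      rw [← ih]; linear_combination this
  change D s = _
  rw [hconst s]
  exact tendsto_nhds_unique tendsto_const_nhds (hlim.congr fun n : ℕ => hconst n)

/-- The **Jacobi triple product**. -/
theorem qPoch_mul_qTheta {z : ℂ} (hz : z ≠ 0) :
    qPoch q q * qTheta z q = ∑' s : ℤ, (-1) ^ s * (q ^ triangular s * z ^ s) := by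
  have hz' : q / z ≠ 0 := div_ne_zero hq0 hz
  have h1 := summable_norm_eulerTerm hq0 hq1 hz
  have h2 := summable_norm_eulerTerm hq0 hq1 hz'
  rw [qTheta, ← tsum_eulerTerm hq0 hq1 hz, ← tsum_eulerTerm hq0 hq1 hz',
    tsum_mul_tsum_of_summable_norm h1 h2, tsum_shear 1 (summable_mul_of_summable_norm h1 h2)]
  -- The difference `s` of the two Euler indices is the power of `z`; what is left is the Durfee
  -- series, whose sum does not depend on `s`.
  have key : ∀ s j : ℤ, eulerTerm q z (s + 1 * j) * eulerTerm q (q / z) j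
      = (-1) ^ s * (q ^ triangular s * z ^ s) * durfeeTerm q s j := by
    intro s j
    have a1 : q ^ triangular (s + j) * q ^ triangular j * q ^ j
        = q ^ triangular s * q ^ (j ^ 2 + j * s) := by
      rw [← zpow_add₀ hq0, ← zpow_add₀ hq0, ← zpow_add₀ hq0]
      congr 1
      linarith [two_mul_triangular (s + j), two_mul_triangular j, two_mul_triangular s]
    have a2 := neg_one_zpow_mul_self j
    have a3 : z ^ j * (z ^ j)⁻¹ = 1 := mul_inv_cancel₀ (zpow_ne_zero _ hz)
    rw [one_mul, eulerTerm, eulerTerm, durfeeTerm, div_zpow, zpow_add₀ hz,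
      zpow_add₀ (show (-1 : ℂ) ≠ 0 by norm_num), add_comm j s, div_eq_mul_inv]
    calc _ = (-1 : ℂ) ^ s * ((-1) ^ j * (-1) ^ j) * (z ^ s * (z ^ j * (z ^ j)⁻¹)) *
          (q ^ triangular (s + j) * q ^ triangular j * q ^ j) *
          (qFactInv q j * qFactInv q (s + j)) := by ring
      _ = _ := by rw [a1, a2, a3]; ring
  simp only [key, tsum_mul_left, tsum_durfeeTerm hq0 hq1, tsum_mul_right]
  field_simp [qPoch_self_ne_zero hq1]

/-! ### Finite Rogers-type identities -/

omit hq0 hq1 in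
/-- The finite theta sum `∑_r q ^ (6 r ^ 2 + b r) / ((q; q)_{k - 3 r} (q; q)_{l + 3 r})`. -/
def rogersSum (q : ℂ) (b k l : ℤ) : ℂ :=
  ∑' r : ℤ, q ^ (6 * r ^ 2 + b * r) * (qFactInv q (k - 3 * r) * qFactInv q (l + 3 * r))

theorem summable_norm_sixSq (b : ℤ) : Summable fun r : ℤ => ‖q ^ (6 * r ^ 2 + b * r)‖ :=
  summable_norm_zpow hq0 hq1 (A := 6) (B := b) (C := 0) (by norm_num) fun r => by push_cast; ring

theorem summable_rogersSum (b k l : ℤ) : Summable fun r : ℤ =>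
    q ^ (6 * r ^ 2 + b * r) * (qFactInv q (k - 3 * r) * qFactInv q (l + 3 * r)) := by
  obtain ⟨K, -, hK⟩ := exists_norm_qFactInv_mul_le hq0 hq1
  exact ((summable_norm_sixSq hq0 hq1 b).norm_mul_of_norm_le fun r => hK _ _).of_norm

omit hq0 hq1 in
theorem rogersSum_neg (b k l : ℤ) : rogersSum q (-b) k l = rogersSum q b l k := by
  rw [rogersSum, ← (Equiv.neg ℤ).tsum_eq]
  refine tsum_congr fun r => ?_
  simp only [Equiv.neg_apply]
  rw [mul_comm (qFactInv q _)]
  ring_nf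

omit hq1 in
-- Substitute `r ↦ -1 - r`.
theorem rogersSum_reflect (b k l : ℤ) :
    rogersSum q b k l = q ^ (6 - b) * rogersSum q (12 - b) (l - 3) (k + 3) := by
  rw [rogersSum, rogersSum, ← (Equiv.subLeft (-1 : ℤ)).tsum_eq, ← tsum_mul_left]
  refine tsum_congr fun r => ?_
  simp only [Equiv.subLeft_apply]
  rw [← mul_assoc (q ^ (6 - b)), ← zpow_add₀ hq0, mul_comm (qFactInv q (k - _))]
  ring_nf

/-- Termwise, `1 - q^(k+l) = (1 - q^(k-3r)) + q^(k-3r) (1 - q^(l+3r))`; each bracket lowers one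
factorial index, and `q^(-3r)` lowers `b` by 3. -/
theorem rogersSum_pascal_left (b k l : ℤ) :
    (1 - q ^ (k + l)) * rogersSum q b k l =
      rogersSum q b (k - 1) l + q ^ k * rogersSum q (b - 3) k (l - 1) := by
  rw [rogersSum, rogersSum, rogersSum, ← tsum_mul_left, ← tsum_mul_left,
    ← (summable_rogersSum hq0 hq1 _ _ _).tsum_add ((summable_rogersSum hq0 hq1 _ _ _).mul_left _)]
  refine tsum_congr fun r => ?_
  rw [show k - 1 - 3 * r = k - 3 * r - 1 by ring, show l - 1 + 3 * r = l + 3 * r - 1 by ring,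
    qFactInv_pred hq0 hq1, qFactInv_pred hq0 hq1]
  have a1 : q ^ (6 * r ^ 2 + b * r) * q ^ (k - 3 * r)
      = q ^ k * q ^ (6 * r ^ 2 + (b - 3) * r) := by
    rw [← zpow_add₀ hq0, ← zpow_add₀ hq0]; congr 1; ring
  have a2 : q ^ (k + l) = q ^ (k - 3 * r) * q ^ (l + 3 * r) := by
    rw [← zpow_add₀ hq0]; congr 1; ring
  rw [a2]
  linear_combination (1 - q ^ (l + 3 * r)) * (qFactInv q (k - 3 * r) * qFactInv q (l + 3 * r)) * a1

theorem rogersSum_pascal_right (b k l : ℤ) :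
    (1 - q ^ (k + l)) * rogersSum q b k l =
      rogersSum q b k (l - 1) + q ^ l * rogersSum q (b + 3) (k - 1) l := by
  have h := rogersSum_pascal_left hq0 hq1 (-b) l k
  rw [rogersSum_neg, rogersSum_neg, show -b - 3 = -(b + 3) by ring, rogersSum_neg,
    add_comm l k] at h
  exact h

omit hq0 in
theorem one_sub_zpow_ne_zero {m : ℤ} (hm : 0 < m) : 1 - q ^ m ≠ 0 := by
  lift m to ℕ using hm.le
  intro h
  have h1 : ‖q ^ m‖ = 1 := by rw [← zpow_natCast, ← sub_eq_zero.1 h, norm_one]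
  rw [norm_pow] at h1
  exact (pow_lt_one₀ (norm_nonneg _) hq1 (by rintro rfl; simp at hm)).ne h1

theorem rogersSum_eq_zero {b k l : ℤ} (h : k + l < 0) : rogersSum q b k l = 0 := by
  rw [rogersSum]
  convert tsum_zero with r
  rcases lt_or_ge (k - 3 * r) 0 with hr | hr
  · simp [qFactInv_of_neg hq0 hq1 hr]
  · simp [qFactInv_of_neg hq0 hq1 (show l + 3 * r < 0 by omega)]

theorem rogersSum_zero_zero (b : ℤ) : rogersSum q b 0 0 = 1 := by
  rw [rogersSum, tsum_eq_single 0]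
  · simp [qFactInv_zero hq1]
  · intro r hr
    rcases lt_or_gt_of_ne hr with hr | hr
    · simp [qFactInv_of_neg hq0 hq1 (show 3 * r < 0 by omega)]
    · simp [qFactInv_of_neg hq0 hq1 (show -(3 * r) < 0 by omega)]

theorem rogersSum_neg_one_one (b : ℤ) : rogersSum q b (-1) 1 = 0 := by
  rw [rogersSum]
  convert tsum_zero with r
  rcases lt_or_ge r 0 with hr | hr
  · simp [qFactInv_of_neg hq0 hq1 (show 1 + 3 * r < 0 by omega)]
  · simp [qFactInv_of_neg hq0 hq1 (show -1 - 3 * r < 0 by omega)]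

/-- The left Pascal rule applied to both sums produces the same extra term `q^n rogersSum q 2 (n -
1) n`, up to `r ↦ -r`, and it cancels. -/
theorem rogersSum_even_step (n : ℤ) :
    (1 - q ^ (2 * n)) * (rogersSum q 1 n n - q * rogersSum q 5 (n - 1) (n + 1)) =
      rogersSum q 1 (n - 1) n - q * rogersSum q 5 (n - 2) (n + 1) := by
  have h1 := rogersSum_pascal_left hq0 hq1 1 n n
  have h2 := rogersSum_pascal_left hq0 hq1 5 (n - 1) (n + 1)
  have h3 := rogersSum_neg (q := q) 2 n (n - 1)
  norm_num at h1
  rw [show n - 1 + (n + 1) = 2 * n by ring, show n - 1 - 1 = n - 2 by ring,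
    show n + 1 - 1 = n by ring, show (5 : ℤ) - 3 = 2 by norm_num, zpow_sub_one₀ hq0] at h2
  rw [← two_mul, h3] at h1
  linear_combination h1 - q * h2 - q ^ n * rogersSum q 2 (n - 1) n * mul_inv_cancel₀ hq0

/-- The right Pascal rule leaves extra terms with `b = 4` and `b = 8`; reflection identifies them
and they cancel. -/
theorem rogersSum_odd_step (n : ℤ) :
    (1 - q ^ (2 * n + 1)) * (rogersSum q 1 n (n + 1) - q * rogersSum q 5 (n - 1) (n + 2)) =
      rogersSum q 1 n n - q * rogersSum q 5 (n - 1) (n + 1) := by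
  have h1 := rogersSum_pascal_right hq0 hq1 1 n (n + 1)
  have h2 := rogersSum_pascal_right hq0 hq1 5 (n - 1) (n + 2)
  have h3 := rogersSum_reflect hq0 8 (n - 2) (n + 2)
  rw [show n + (n + 1) = 2 * n + 1 by ring, show n + 1 - 1 = n by ring,
    show (1 : ℤ) + 3 = 4 by norm_num, zpow_add_one₀ hq0 n] at h1
  rw [show n - 1 + (n + 2) = 2 * n + 1 by ring, show n + 2 - 1 = n + 1 by ring,
    show (5 : ℤ) + 3 = 8 by norm_num, show n - 1 - 1 = n - 2 by ring, h3,
    show (12 : ℤ) - 8 = 4 by norm_num, show n + 2 - 3 = n - 1 by ring,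
    show n - 2 + 3 = n + 1 by ring, ← mul_assoc, ← zpow_add₀ hq0,
    show n + 2 + (6 - 8) = n by ring] at h2
  linear_combination h1 - q * h2

/-- Both sides obey `(1 - q^m) f_m = f_{m-1}`, with `m` alternating between even and odd, and agree
at `m = 0`. -/
theorem rogersSum_even_odd (n : ℕ) :
    rogersSum q 1 n n - q * rogersSum q 5 (n - 1) (n + 1) = qFactInv q (2 * n) ∧
    rogersSum q 1 n (n + 1) - q * rogersSum q 5 (n - 1) (n + 2) = qFactInv q (2 * n + 1) := by
  have hodd : ∀ n : ℕ,
      rogersSum q 1 n n - q * rogersSum q 5 (n - 1) (n + 1) = qFactInv q (2 * n) →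
      rogersSum q 1 n (n + 1) - q * rogersSum q 5 (n - 1) (n + 2) = qFactInv q (2 * n + 1) := by
    intro n hn
    refine mul_left_cancel₀ (one_sub_zpow_ne_zero hq1 (show 0 < 2 * (n : ℤ) + 1 by omega)) ?_
    rw [rogersSum_odd_step hq0 hq1, hn, ← qFactInv_pred hq0 hq1, add_sub_cancel_right]
  induction n with
  | zero =>
    have h0 : rogersSum q 1 ((0 : ℕ) : ℤ) ((0 : ℕ) : ℤ)
        - q * rogersSum q 5 (((0 : ℕ) : ℤ) - 1) (((0 : ℕ) : ℤ) + 1)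
        = qFactInv q (2 * ((0 : ℕ) : ℤ)) := by
      simp [rogersSum_zero_zero hq0 hq1, rogersSum_neg_one_one hq0 hq1, qFactInv_zero hq1]
    exact ⟨h0, hodd 0 h0⟩
  | succ n ih =>
    refine (and_iff_left_of_imp (hodd (n + 1))).2 ?_
    refine mul_left_cancel₀
      (one_sub_zpow_ne_zero hq1 (show 0 < 2 * ((n + 1 : ℕ) : ℤ) by omega)) ?_
    rw [rogersSum_even_step hq0 hq1, ← qFactInv_pred hq0 hq1]
    convert ih.2 using 3 <;> push_cast <;> ring_nf

theorem rogersSum_even (n : ℤ) :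
    rogersSum q 1 n n - q * rogersSum q 5 (n - 1) (n + 1) = qFactInv q (2 * n) := by
  rcases lt_or_ge n 0 with hn | hn
  · rw [rogersSum_eq_zero hq0 hq1 (by omega), rogersSum_eq_zero hq0 hq1 (by omega),
      qFactInv_of_neg hq0 hq1 (by omega)]
    ring
  · lift n to ℕ using hn
    exact (rogersSum_even_odd hq0 hq1 n).1

theorem rogersSum_odd (n : ℤ) :
    rogersSum q 1 n (n + 1) - q * rogersSum q 5 (n - 1) (n + 2) = qFactInv q (2 * n + 1) := by
  rcases lt_or_ge n 0 with hn | hn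
  · rw [rogersSum_eq_zero hq0 hq1 (by omega), rogersSum_eq_zero hq0 hq1 (by omega),
      qFactInv_of_neg hq0 hq1 (by omega)]
    ring
  · lift n to ℕ using hn
    exact (rogersSum_even_odd hq0 hq1 n).2

/-- The left rule on the first sum and the right rule on the second share a main term; the remaining
terms form `q^n` times the odd identity at `n - 1`. At `n = 0` the factor `1 - q^(2n)` cannot be
cancelled, hence the separate case. -/
theorem rogersSum_even_twisted (n : ℤ) :
    rogersSum q 2 n n - rogersSum q 2 (n - 1) (n + 1) = q ^ n * qFactInv q (2 * n) := by
  rcases lt_trichotomy n 0 with hn | rfl | hn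
  · rw [rogersSum_eq_zero hq0 hq1 (by omega), rogersSum_eq_zero hq0 hq1 (by omega),
      qFactInv_of_neg hq0 hq1 (by omega)]
    ring
  · simp [rogersSum_zero_zero hq0 hq1, rogersSum_neg_one_one hq0 hq1, qFactInv_zero hq1]
  · have h1 := rogersSum_pascal_left hq0 hq1 2 n n
    have h2 := rogersSum_pascal_right hq0 hq1 2 (n - 1) (n + 1)
    have h3 := rogersSum_neg (q := q) 1 n (n - 1)
    have h4 := rogersSum_odd hq0 hq1 (n - 1)
    have h5 := qFactInv_pred hq0 hq1 (2 * n)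
    refine mul_left_cancel₀ (one_sub_zpow_ne_zero hq1 (show 0 < 2 * n by omega)) ?_
    rw [show (2 : ℤ) - 3 = -1 by norm_num, h3, ← two_mul] at h1
    rw [show n - 1 + (n + 1) = 2 * n by ring, show n - 1 - 1 = n - 2 by ring,
      show n + 1 - 1 = n by ring, show (2 : ℤ) + 3 = 5 by norm_num, zpow_add_one₀ hq0] at h2
    rw [show n - 1 - 1 = n - 2 by ring, show n - 1 + 1 = n by ring,
      show n - 1 + 2 = n + 1 by ring, show 2 * (n - 1) + 1 = 2 * n - 1 by ring, h5] at h4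
    linear_combination h1 - h2 + q ^ n * h4

/-- The same mixture of Pascal rules, followed by a reflection from `b = 7` to `b = 5`, reduces this
to the even identity at `n`. -/
theorem rogersSum_odd_twisted (n : ℤ) :
    rogersSum q 4 n (n + 1) - rogersSum q 4 (n - 1) (n + 2) = q ^ n * qFactInv q (2 * n + 1) := by
  rcases lt_or_ge n 0 with hn | hn
  · rw [rogersSum_eq_zero hq0 hq1 (by omega), rogersSum_eq_zero hq0 hq1 (by omega),
      qFactInv_of_neg hq0 hq1 (by omega)]
    ring
  · have h1 := rogersSum_pascal_left hq0 hq1 4 n (n + 1)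
    have h2 := rogersSum_pascal_right hq0 hq1 4 (n - 1) (n + 2)
    have h3 := rogersSum_reflect hq0 7 (n - 2) (n + 2)
    have h4 := rogersSum_even hq0 hq1 n
    have h5 := qFactInv_pred hq0 hq1 (2 * n + 1)
    refine mul_left_cancel₀ (one_sub_zpow_ne_zero hq1 (show 0 < 2 * n + 1 by omega)) ?_
    rw [show n + (n + 1) = 2 * n + 1 by ring, show n + 1 - 1 = n by ring,
      show (4 : ℤ) - 3 = 1 by norm_num] at h1
    rw [show n - 1 + (n + 2) = 2 * n + 1 by ring, show n + 2 - 1 = n + 1 by ring,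
      show (4 : ℤ) + 3 = 7 by norm_num, show n - 1 - 1 = n - 2 by ring, h3,
      show (12 : ℤ) - 7 = 5 by norm_num, show n + 2 - 3 = n - 1 by ring,
      show n - 2 + 3 = n + 1 by ring, ← mul_assoc, ← zpow_add₀ hq0,
      show n + 2 + (6 - 7) = n + 1 by ring, zpow_add_one₀ hq0 n] at h2
    rw [add_sub_cancel_right] at h5
    rw [h5] at h4
    linear_combination h1 - h2 + q ^ n * h4

end

/-! ### The quintuple product -/

theorem qPoch_trisect {a q : ℂ} (hq1 : ‖q‖ < 1) :
    qPoch a q = qPoch a (q ^ 3) * qPoch (a * q) (q ^ 3) * qPoch (a * q ^ 2) (q ^ 3) := by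
  have hq3 : ‖q ^ 3‖ < 1 := by
    rw [norm_pow]; exact pow_lt_one₀ (norm_nonneg _) hq1 (by norm_num)
  have hprod : ∀ n : ℕ, ∏ k ∈ Finset.range (3 * n), (1 - a * q ^ k) =
      (∏ k ∈ Finset.range n, (1 - a * (q ^ 3) ^ k)) *
      (∏ k ∈ Finset.range n, (1 - a * q * (q ^ 3) ^ k)) *
      ∏ k ∈ Finset.range n, (1 - a * q ^ 2 * (q ^ 3) ^ k) := by
    intro n
    induction n with
    | zero => simp
    | succ n ih =>
      rw [show 3 * (n + 1) = 3 * n + 1 + 1 + 1 by ring]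
      simp only [Finset.prod_range_succ, ih, pow_succ]
      ring
  have h1 := (tendsto_qPoch a hq1).comp
    (Filter.tendsto_atTop_mono (fun n : ℕ => show n ≤ 3 * n by omega) Filter.tendsto_id)
  have h2 := ((tendsto_qPoch a hq3).mul (tendsto_qPoch (a * q) hq3)).mul
    (tendsto_qPoch (a * q ^ 2) hq3)
  exact tendsto_nhds_unique (h1.congr fun n => hprod n) h2

theorem tsum_tsum_of_shear {G : ℤ → ℤ → ℂ} {f g : ℤ → ℂ} (a : ℤ)
    (hf : Summable fun n => ‖f n‖) (hg : Summable fun n => ‖g n‖)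
    (h : ∀ n j, G (n + a * j) j = f n * g j) :
    (Summable fun n => ∑' j, G n j) ∧ ∑' n, ∑' j, G n j = (∑' n, f n) * ∑' j, g j := by
  have hG : (fun p : ℤ × ℤ => G p.1 p.2) ∘ shearEquiv a = fun p => f p.1 * g p.2 :=
    funext fun p => h p.1 p.2
  have hs : Summable fun p : ℤ × ℤ => G p.1 p.2 := by
    rw [← (shearEquiv a).summable_iff, hG]
    exact summable_mul_of_summable_norm hf hg
  refine ⟨hs.prod, ?_⟩
  rw [tsum_mul_tsum_of_summable_norm hf hg, ← hG]
  exact hs.tsum_prod.symm.trans ((shearEquiv a).tsum_eq fun p : ℤ × ℤ => G p.1 p.2).symm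

section

variable {q : ℂ} (hq0 : q ≠ 0) (hq1 : ‖q‖ < 1)
include hq0 hq1

/-- **Euler's pentagonal number theorem** in base `q ^ 2`. -/
theorem tsum_pentagonal :
    ∑' j : ℤ, (-1 : ℂ) ^ j * q ^ (3 * j ^ 2 + j) = qPoch (q ^ 2) (q ^ 2) := by
  have hpow : ∀ n : ℕ, n ≠ 0 → ‖q ^ n‖ < 1 := fun n hn => by
    rw [norm_pow]; exact pow_lt_one₀ (norm_nonneg _) hq1 hn
  have h := qPoch_mul_qTheta (pow_ne_zero 6 hq0) (hpow 6 (by norm_num)) (pow_ne_zero 4 hq0)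
  have hd : q ^ 6 / q ^ 4 = q ^ 2 := by field_simp
  have e1 : (q ^ 2) ^ 3 = q ^ 6 := by ring
  have e2 : q ^ 2 * q ^ 2 = q ^ 4 := by ring
  have e3 : q ^ 2 * (q ^ 2) ^ 2 = q ^ 6 := by ring
  rw [qPoch_trisect (hpow 2 (by norm_num)), e1, e2, e3]
  rw [qTheta, hd] at h
  rw [show qPoch (q ^ 2) (q ^ 6) * qPoch (q ^ 4) (q ^ 6) * qPoch (q ^ 6) (q ^ 6)
    = qPoch (q ^ 6) (q ^ 6) * (qPoch (q ^ 4) (q ^ 6) * qPoch (q ^ 2) (q ^ 6)) by ring, h]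
  refine tsum_congr fun j => ?_
  rw [← zpow_natCast, ← zpow_natCast, ← _root_.zpow_mul, ← _root_.zpow_mul, ← zpow_add₀ hq0]
  congr 2
  push_cast
  linarith [two_mul_triangular j]

omit hq0 hq1 in
theorem neg_one_zpow_neg (j : ℤ) : (-1 : ℂ) ^ (-j) = (-1) ^ j := by
  rw [_root_.zpow_neg, ← _root_.inv_zpow]; norm_num

/-- The **quintuple product identity**. -/
theorem qPoch_mul_qTheta_mul_qTheta {z : ℂ} (hz : z ≠ 0) :
    qPoch q q * (qTheta z q * qTheta (q / z ^ 2) (q ^ 2)) =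
      ∑' k : ℤ, q ^ (3 * triangular k + k) * z ^ (3 * k) -
        ∑' k : ℤ, q ^ (3 * triangular k + 2 * k) * z ^ (3 * k + 1) := by
  have hq2 : q ^ 2 ≠ 0 := pow_ne_zero 2 hq0
  have hq2' : ‖q ^ 2‖ < 1 := by
    rw [norm_pow]; exact pow_lt_one₀ (norm_nonneg _) hq1 (by norm_num)
  have hne : (-1 : ℂ) ≠ 0 := by norm_num
  have hw : q / z ^ 2 ≠ 0 := div_ne_zero hq0 (pow_ne_zero 2 hz)
  have J1 := qPoch_mul_qTheta hq0 hq1 hz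
  have J2 := qPoch_mul_qTheta hq2 hq2' hw
  have s1 : Summable fun i : ℤ => ‖(-1 : ℂ) ^ i * (q ^ triangular i * z ^ i)‖ := by
    simpa using summable_norm_zpow_mul_zpow hq0 hq1 hz (by norm_num) triangular_cast 1 0
  have s2 : Summable fun i : ℤ =>
      ‖(-1 : ℂ) ^ i * ((q ^ 2) ^ triangular i * (q / z ^ 2) ^ i)‖ := by
    simpa using summable_norm_zpow_mul_zpow hq2 hq2' hw (by norm_num) triangular_cast 1 0
  set G : ℤ → ℂ := fun N => ∑' j : ℤ, (-1 : ℂ) ^ j * q ^ (triangular (N + 2 * j) + j ^ 2) with hG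
  -- Multiplying the two triple products, `G N` collects, up to sign, the coefficient of `z^N`.
  have key : ∀ N j : ℤ, (-1 : ℂ) ^ (N + 2 * j) * (q ^ triangular (N + 2 * j) * z ^ (N + 2 * j)) *
      ((-1 : ℂ) ^ j * ((q ^ 2) ^ triangular j * (q / z ^ 2) ^ j)) =
      ((-1) ^ N * z ^ N) * ((-1 : ℂ) ^ j * q ^ (triangular (N + 2 * j) + j ^ 2)) := by
    intro N j
    have a1 : (q ^ 2) ^ triangular j * q ^ j = q ^ (j ^ 2) := by
      rw [← zpow_natCast, ← _root_.zpow_mul, ← zpow_add₀ hq0]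
      congr 1
      push_cast
      linarith [two_mul_triangular j]
    have a2 : z ^ (N + 2 * j) = z ^ N * (z ^ 2) ^ j := by
      rw [← zpow_natCast, ← _root_.zpow_mul, ← zpow_add₀ hz]
      congr 1
    have a3 : (-1 : ℂ) ^ (N + 2 * j) = (-1) ^ N := by
      rw [zpow_add₀ hne, _root_.zpow_mul]; norm_num
    have a4 : (z ^ 2) ^ j ≠ 0 := zpow_ne_zero _ (pow_ne_zero 2 hz)
    rw [a3, a2, div_zpow, zpow_add₀ hq0, ← a1]
    field_simp
  have hsum := summable_mul_of_summable_norm s1 s2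
  have hGs : Summable fun N : ℤ => (-1 : ℂ) ^ N * z ^ N * G N := by
    refine (summable_shear 2 hsum).prod.congr fun N => ?_
    simp only [key, tsum_mul_left, hG]
  have hprod : (∑' i : ℤ, (-1 : ℂ) ^ i * (q ^ triangular i * z ^ i)) *
      ∑' i : ℤ, (-1 : ℂ) ^ i * ((q ^ 2) ^ triangular i * (q / z ^ 2) ^ i) =
      ∑' N : ℤ, (-1 : ℂ) ^ N * z ^ N * G N := by
    rw [tsum_mul_tsum_of_summable_norm s1 s2, tsum_shear 2 hsum]
    simp only [key, tsum_mul_left, hG]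
  -- The substitution `j ↦ -k - j` completes the square, so the exponent has no `jk` term.
  have hshift : ∀ (k t : ℤ), G (3 * k + t) = (-1) ^ k * q ^ (3 * triangular k + k + t * k) *
      ∑' j : ℤ, (-1 : ℂ) ^ j * q ^ (3 * j ^ 2 + (1 - 2 * t) * j + triangular t) := by
    intro k t
    rw [hG, ← tsum_mul_left]
    change ∑' j : ℤ, (-1 : ℂ) ^ j * q ^ (triangular (3 * k + t + 2 * j) + j ^ 2) = _
    rw [← (Equiv.subLeft (-k)).tsum_eq]
    refine tsum_congr fun j => ?_
    have a1 : q ^ (triangular (3 * k + t + 2 * (-k - j)) + (-k - j) ^ 2) =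
        q ^ (3 * triangular k + k + t * k) *
          q ^ (3 * j ^ 2 + (1 - 2 * t) * j + triangular t) := by
      rw [← zpow_add₀ hq0]
      congr 1
      linarith [two_mul_triangular (3 * k + t + 2 * (-k - j)), two_mul_triangular k,
        two_mul_triangular t]
    rw [Equiv.subLeft_apply, a1, zpow_sub₀ hne, neg_one_zpow_neg, div_eq_mul_inv,
      ← _root_.zpow_neg, neg_one_zpow_neg]
    ring
  have hpent := tsum_pentagonal hq0 hq1
  have g0 : ∀ k, G (3 * k) =
      (-1) ^ k * q ^ (3 * triangular k + k) * qPoch (q ^ 2) (q ^ 2) := fun k => by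
    simpa [triangular, hpent] using hshift k 0
  have g1 : ∀ k, G (3 * k + 1) =
      (-1) ^ k * q ^ (3 * triangular k + 2 * k) * qPoch (q ^ 2) (q ^ 2) := fun k => by
    rw [hshift k 1, ← hpent, ← (Equiv.neg ℤ).tsum_eq, show 3 * triangular k + k + 1 * k
      = 3 * triangular k + 2 * k by ring]
    congr 1
    refine tsum_congr fun j => ?_
    rw [Equiv.neg_apply, neg_one_zpow_neg]
    congr 2
    rw [show triangular 1 = 0 from rfl]
    ring
  -- For residue 2 the exponent `3j² - 3j + 1` is invariant under `j ↦ 1 - j` while the sign flips.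
  have g2 : ∀ k, G (3 * k + 2) = 0 := fun k => by
    rw [hshift k 2]
    have : ∀ S : ℂ, S = -S → S = 0 := fun S hS => by linear_combination hS / 2
    rw [this (∑' j : ℤ, _), mul_zero]
    rw [← tsum_neg, ← (Equiv.subLeft (1 : ℤ)).tsum_eq]
    refine tsum_congr fun j => ?_
    have a1 : (-1 : ℂ) ^ (1 - j) = -(-1) ^ j := by
      rw [zpow_sub₀ hne, zpow_one, div_eq_mul_inv, ← _root_.zpow_neg, neg_one_zpow_neg, neg_one_mul]
    rw [Equiv.subLeft_apply, a1, neg_mul]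
    congr 3
    ring
  rw [tsum_int_eq_sum_tsum_mod 3 hGs] at hprod
  simp only [Fin.sum_univ_three, Fin.val_zero, Fin.val_one, Fin.val_two, Nat.cast_ofNat,
    Nat.cast_zero, Nat.cast_one, add_zero, g0, g1, g2, mul_zero, tsum_zero] at hprod
  have h3 : ∀ k : ℤ, (-1 : ℂ) ^ (3 * k) = (-1) ^ k := fun k => by
    rw [_root_.zpow_mul]; norm_num
  have t0 : ∀ k : ℤ, (-1 : ℂ) ^ (3 * k) * z ^ (3 * k) *
      ((-1) ^ k * q ^ (3 * triangular k + k) * qPoch (q ^ 2) (q ^ 2)) =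
      q ^ (3 * triangular k + k) * z ^ (3 * k) * qPoch (q ^ 2) (q ^ 2) := fun k => by
    rw [h3]
    linear_combination (z ^ (3 * k) * q ^ (3 * triangular k + k) * qPoch (q ^ 2) (q ^ 2)) *
      neg_one_zpow_mul_self k
  have t1 : ∀ k : ℤ, (-1 : ℂ) ^ (3 * k + 1) * z ^ (3 * k + 1) *
      ((-1) ^ k * q ^ (3 * triangular k + 2 * k) * qPoch (q ^ 2) (q ^ 2)) =
      -(q ^ (3 * triangular k + 2 * k) * z ^ (3 * k + 1)) * qPoch (q ^ 2) (q ^ 2) := fun k => by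
    rw [zpow_add₀ hne, zpow_one, h3]
    linear_combination -(z ^ (3 * k + 1) * q ^ (3 * triangular k + 2 * k) *
      qPoch (q ^ 2) (q ^ 2)) * neg_one_zpow_mul_self k
  simp only [t0, t1, tsum_mul_right, tsum_neg, ← J1, ← J2] at hprod
  refine mul_right_cancel₀ (qPoch_self_ne_zero hq2') ?_
  linear_combination hprod

/-! ### The four modulo 20 identities -/

/-- For fixed `r`, the shift `n ↦ n + 3r + u` turns the sum over `n` into a Durfee series with
parameter `2(3r + u) + ε`. -/
theorem tsum_mul_rogersSum (ε b u : ℤ) :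
    (Summable fun n : ℤ => q ^ (n ^ 2 + ε * n) * rogersSum q b (n - u) (n + u + ε)) ∧
    ∑' n : ℤ, q ^ (n ^ 2 + ε * n) * rogersSum q b (n - u) (n + u + ε) =
      (qPoch q q)⁻¹ * ∑' r : ℤ, q ^ (6 * r ^ 2 + b * r + ((3 * r + u) ^ 2 + ε * (3 * r + u))) := by
  obtain ⟨K, -, hK⟩ := exists_norm_qFactInv_mul_le hq0 hq1
  set F : ℤ × ℤ → ℂ := fun p => q ^ (p.1 ^ 2 + ε * p.1) * q ^ (6 * p.2 ^ 2 + b * p.2) *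
    (qFactInv q (p.1 - u - 3 * p.2) * qFactInv q (p.1 + u + ε + 3 * p.2)) with hF
  have s1 : Summable fun n : ℤ => ‖q ^ (n ^ 2 + ε * n)‖ :=
    summable_norm_zpow hq0 hq1 (A := 1) (B := ε) (C := 0) one_pos fun n => by push_cast; ring
  have hFs : Summable F :=
    ((s1.mul_norm (summable_norm_sixSq hq0 hq1 b)).norm_mul_of_norm_le fun p => hK _ _).of_norm
  have e1 : ∀ n : ℤ, q ^ (n ^ 2 + ε * n) * rogersSum q b (n - u) (n + u + ε) =
      ∑' r, F (n, r) := fun n => by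
    simp only [hF, rogersSum, mul_assoc, tsum_mul_left]
  simp only [e1]
  refine ⟨hFs.prod, ?_⟩
  have hcomm : ∑' n, ∑' r, F (n, r) = ∑' r, ∑' n, F (n, r) :=
    (Summable.tsum_comm (f := fun n r => F (n, r)) hFs).symm
  rw [hcomm, ← tsum_mul_left]
  refine tsum_congr fun r => ?_
  rw [← (Equiv.addRight (3 * r + u)).tsum_eq]
  have e2 : ∀ j : ℤ, F (Equiv.addRight (3 * r + u) j, r) =
      q ^ (6 * r ^ 2 + b * r + ((3 * r + u) ^ 2 + ε * (3 * r + u))) *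
        durfeeTerm q (2 * (3 * r + u) + ε) j := fun j => by
    simp only [hF, Equiv.coe_addRight, durfeeTerm]
    rw [← zpow_add₀ hq0, ← mul_assoc (q ^ (6 * r ^ 2 + b * r + _)), ← zpow_add₀ hq0]
    ring_nf
  simp only [e2, tsum_mul_left, tsum_durfeeTerm hq0 hq1]
  ring

/-- The quintuple product at `z = q^m`; the condition on `l` says `q^10 / z² = q^l`. -/
theorem qPoch_mul_qTheta_mul_qTheta_pow_ten {m l : ℕ} (h : 2 * m + l = 10) :
    qPoch (q ^ 10) (q ^ 10) * (qTheta (q ^ m) (q ^ 10) * qTheta (q ^ l) (q ^ 20)) =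
      ∑' k : ℤ, q ^ (15 * k ^ 2 + (3 * m - 5) * k) -
        ∑' k : ℤ, q ^ (15 * k ^ 2 + (3 * m + 5) * k + m) := by
  have h10 : ‖q ^ 10‖ < 1 := by
    rw [norm_pow]; exact pow_lt_one₀ (norm_nonneg _) hq1 (by norm_num)
  have hQ := qPoch_mul_qTheta_mul_qTheta (pow_ne_zero 10 hq0) h10 (pow_ne_zero m hq0)
  have e1 : q ^ 10 / (q ^ m) ^ 2 = q ^ l := by
    rw [← h, pow_add, mul_comm 2 m, pow_mul]
    field_simp
  rw [e1, ← pow_mul] at hQ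
  rw [hQ]
  congr 1 <;> refine tsum_congr fun k => ?_ <;>
  · rw [← zpow_natCast, ← zpow_natCast, ← _root_.zpow_mul, ← _root_.zpow_mul, ← zpow_add₀ hq0]
    congr 1
    push_cast
    linarith [two_mul_triangular k]

theorem tsum_even_zero :
    ∑' n : ℤ, q ^ (n ^ 2) * qFactInv q (2 * n) =
      qPoch (q ^ 10) (q ^ 10) / qPoch q q * (qTheta (q ^ 2) (q ^ 10) * qTheta (q ^ 6) (q ^ 20)) := by
  obtain ⟨s1, t1⟩ := tsum_mul_rogersSum hq0 hq1 0 1 0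
  obtain ⟨s2, t2⟩ := tsum_mul_rogersSum hq0 hq1 0 5 1
  have hQ := qPoch_mul_qTheta_mul_qTheta_pow_ten hq0 hq1 (m := 2) (l := 6) rfl
  have e : ∀ n : ℤ, q ^ (n ^ 2) * qFactInv q (2 * n) =
      q ^ (n ^ 2 + 0 * n) * rogersSum q 1 (n - 0) (n + 0 + 0) -
        q * (q ^ (n ^ 2 + 0 * n) * rogersSum q 5 (n - 1) (n + 1 + 0)) := fun n => by
    rw [← rogersSum_even hq0 hq1]; simp only [zero_mul, add_zero, sub_zero]; ring
  simp only [e]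
  rw [s1.tsum_sub (s2.mul_left q), tsum_mul_left, t1, t2, div_mul_eq_mul_div, hQ, div_eq_inv_mul,
    mul_sub, mul_left_comm q, ← tsum_mul_left (a := q)]
  congr 2 <;> refine tsum_congr fun k => ?_
  · congr 1; push_cast; ring
  · rw [← zpow_one_add₀ hq0]; congr 1; push_cast; ring

theorem tsum_even_one :
    ∑' n : ℤ, q ^ (n ^ 2 + n) * qFactInv q (2 * n) =
      qPoch (q ^ 10) (q ^ 10) / qPoch q q * (qTheta q (q ^ 10) * qTheta (q ^ 8) (q ^ 20)) := by
  obtain ⟨s1, t1⟩ := tsum_mul_rogersSum hq0 hq1 0 2 0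
  obtain ⟨s2, t2⟩ := tsum_mul_rogersSum hq0 hq1 0 2 1
  have hQ := qPoch_mul_qTheta_mul_qTheta_pow_ten hq0 hq1 (m := 1) (l := 8) rfl
  rw [pow_one] at hQ
  have e : ∀ n : ℤ, q ^ (n ^ 2 + n) * qFactInv q (2 * n) =
      q ^ (n ^ 2 + 0 * n) * rogersSum q 2 (n - 0) (n + 0 + 0) -
        q ^ (n ^ 2 + 0 * n) * rogersSum q 2 (n - 1) (n + 1 + 0) := fun n => by
    rw [zpow_add₀ hq0, mul_assoc, ← rogersSum_even_twisted hq0 hq1]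
    simp only [zero_mul, add_zero, sub_zero]; ring
  simp only [e]
  rw [s1.tsum_sub s2, t1, t2, div_mul_eq_mul_div, hQ, div_eq_inv_mul, mul_sub]
  congr 2
  · rw [← (Equiv.neg ℤ).tsum_eq]
    refine tsum_congr fun k => ?_
    rw [Equiv.neg_apply]; congr 1; push_cast; ring
  · refine tsum_congr fun k => ?_
    congr 1; push_cast; ring

theorem tsum_odd_one :
    ∑' n : ℤ, q ^ (n ^ 2 + n) * qFactInv q (2 * n + 1) =
      qPoch (q ^ 10) (q ^ 10) / qPoch q q * (qTheta (q ^ 3) (q ^ 10) * qTheta (q ^ 4) (q ^ 20)) := by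
  obtain ⟨s1, t1⟩ := tsum_mul_rogersSum hq0 hq1 1 1 0
  obtain ⟨s2, t2⟩ := tsum_mul_rogersSum hq0 hq1 1 5 1
  have hQ := qPoch_mul_qTheta_mul_qTheta_pow_ten hq0 hq1 (m := 3) (l := 4) rfl
  have e : ∀ n : ℤ, q ^ (n ^ 2 + n) * qFactInv q (2 * n + 1) =
      q ^ (n ^ 2 + 1 * n) * rogersSum q 1 (n - 0) (n + 0 + 1) -
        q * (q ^ (n ^ 2 + 1 * n) * rogersSum q 5 (n - 1) (n + 1 + 1)) := fun n => by
    rw [← rogersSum_odd hq0 hq1, show n + 1 + 1 = n + 2 by ring]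
    simp only [one_mul, add_zero, sub_zero]; ring
  simp only [e]
  rw [s1.tsum_sub (s2.mul_left q), tsum_mul_left, t1, t2, div_mul_eq_mul_div, hQ, div_eq_inv_mul,
    mul_sub, mul_left_comm q, ← tsum_mul_left (a := q)]
  congr 2 <;> refine tsum_congr fun k => ?_
  · congr 1; push_cast; ring
  · rw [← zpow_one_add₀ hq0]; congr 1; push_cast; ring

theorem tsum_odd_two :
    ∑' n : ℤ, q ^ (n ^ 2 + 2 * n) * qFactInv q (2 * n + 1) =
      qPoch (q ^ 10) (q ^ 10) / qPoch q q * (qTheta (q ^ 4) (q ^ 10) * qTheta (q ^ 2) (q ^ 20)) := by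
  obtain ⟨s1, t1⟩ := tsum_mul_rogersSum hq0 hq1 1 4 0
  obtain ⟨s2, t2⟩ := tsum_mul_rogersSum hq0 hq1 1 4 1
  have hQ := qPoch_mul_qTheta_mul_qTheta_pow_ten hq0 hq1 (m := 4) (l := 2) rfl
  have e : ∀ n : ℤ, q ^ (n ^ 2 + 2 * n) * qFactInv q (2 * n + 1) =
      q ^ (n ^ 2 + 1 * n) * rogersSum q 4 (n - 0) (n + 0 + 1) -
        q ^ (n ^ 2 + 1 * n) * rogersSum q 4 (n - 1) (n + 1 + 1) := fun n => by
    rw [show n ^ 2 + 2 * n = n ^ 2 + n + n by ring, zpow_add₀ hq0 (n ^ 2 + n), mul_assoc,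
      ← rogersSum_odd_twisted hq0 hq1, show n + 1 + 1 = n + 2 by ring]
    simp only [one_mul, add_zero, sub_zero]; ring
  simp only [e]
  rw [s1.tsum_sub s2, t1, t2, div_mul_eq_mul_div, hQ, div_eq_inv_mul, mul_sub]
  congr 2
  · refine tsum_congr fun k => ?_
    congr 1; push_cast; ring
  -- Under `k ↦ -1 - k`, `15k² + 13k + 2` becomes `15k² + 17k + 4`.
  · rw [← (Equiv.subLeft (-1 : ℤ)).tsum_eq]
    refine tsum_congr fun k => ?_
    rw [Equiv.subLeft_apply]; congr 1; push_cast; ring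

/-! ### Expansion in the canonical basis -/

/-- Even Euler indices keep the parity of the power of `x` and yield the vector of index `ε`; odd
ones yield that of index `1 + ε`. -/
theorem tsum_mul_qPoch_expansion {x : ℂ} (hx : x ≠ 0) (ε : ℤ) :
    (Summable fun n : ℤ => q ^ (n ^ 2 + ε * n) * x ^ (2 * n + ε) * qPoch (q ^ (n + 1) * x) q) ∧
    ∑' n : ℤ, q ^ (n ^ 2 + ε * n) * x ^ (2 * n + ε) * qPoch (q ^ (n + 1) * x) q =
      (∑' k : ℤ, q ^ (k ^ 2 + ε * k) * x ^ (2 * k + ε)) *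
        (∑' j : ℤ, q ^ (j ^ 2 + (1 - ε) * j) * qFactInv q (2 * j)) +
      (∑' k : ℤ, q ^ (k ^ 2 + (1 + ε) * k) * x ^ (2 * k + (1 + ε))) *
        (∑' j : ℤ, -(q ^ (j ^ 2 + (2 - ε) * j + 1)) * qFactInv q (2 * j + 1)) := by
  obtain ⟨K, -, hK⟩ := exists_norm_qFactInv_le hq0 hq1
  have sf : ∀ a : ℤ, Summable fun k : ℤ => ‖q ^ (k ^ 2 + a * k) * x ^ (2 * k + a)‖ := fun a =>
    summable_norm_zpow_mul_zpow hq0 hq1 hx (A := 1) (B := a) (C := 0) one_pos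
      (fun n => by push_cast; ring) 2 a
  have sg0 : Summable fun j : ℤ => ‖q ^ (j ^ 2 + (1 - ε) * j) * qFactInv q (2 * j)‖ :=
    (summable_norm_zpow hq0 hq1 (A := 1) (B := 1 - ε) (C := 0) one_pos
      (fun n => by push_cast; ring)).norm_mul_of_norm_le fun j => hK _
  have sg1 : Summable fun j : ℤ =>
      ‖-(q ^ (j ^ 2 + (2 - ε) * j + 1)) * qFactInv q (2 * j + 1)‖ := by
    have := (summable_norm_zpow hq0 hq1 (A := 1) (B := 2 - ε) (C := 1) one_pos
      (e := fun j : ℤ => j ^ 2 + (2 - ε) * j + 1)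
      (fun n => by push_cast; ring)).norm_mul_of_norm_le fun j => hK (2 * j + 1)
    simpa only [neg_mul, norm_neg] using this
  have hne : (-1 : ℂ) ≠ 0 := by norm_num
  have hsign : ∀ j : ℤ, (-1 : ℂ) ^ (2 * j) = 1 := fun j => by rw [_root_.zpow_mul]; norm_num
  have expand : ∀ n m : ℤ, q ^ (n ^ 2 + ε * n) * x ^ (2 * n + ε) *
      eulerTerm q (q ^ (n + 1) * x) m = (-1) ^ m *
        (q ^ (n ^ 2 + ε * n + triangular m + (n + 1) * m) * x ^ (2 * n + ε + m)) *
          qFactInv q m := fun n m => by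
    rw [eulerTerm, mul_zpow, ← _root_.zpow_mul, zpow_add₀ hx _ m, zpow_add₀ hq0 _ ((n + 1) * m),
      zpow_add₀ hq0 _ (triangular m)]
    ring
  obtain ⟨c0, d0⟩ := tsum_tsum_of_shear (G := fun n j => q ^ (n ^ 2 + ε * n) * x ^ (2 * n + ε) *
      eulerTerm q (q ^ (n + 1) * x) (2 * j)) (-1) (sf ε) sg0 fun n j => by
    have a1 : q ^ ((n + -1 * j) ^ 2 + ε * (n + -1 * j) + triangular (2 * j) +
        (n + -1 * j + 1) * (2 * j)) = q ^ (n ^ 2 + ε * n) * q ^ (j ^ 2 + (1 - ε) * j) := by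
      rw [← zpow_add₀ hq0]
      congr 1
      linarith [two_mul_triangular (2 * j)]
    rw [expand, hsign, a1, show 2 * (n + -1 * j) + ε + 2 * j = 2 * n + ε by ring]
    ring
  obtain ⟨c1, d1⟩ := tsum_tsum_of_shear (G := fun n j => q ^ (n ^ 2 + ε * n) * x ^ (2 * n + ε) *
      eulerTerm q (q ^ (n + 1) * x) (2 * j + 1)) (-1) (sf (1 + ε)) sg1 fun n j => by
    have a1 : q ^ ((n + -1 * j) ^ 2 + ε * (n + -1 * j) + triangular (2 * j + 1) +
        (n + -1 * j + 1) * (2 * j + 1)) =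
        q ^ (n ^ 2 + (1 + ε) * n) * q ^ (j ^ 2 + (2 - ε) * j + 1) := by
      rw [← zpow_add₀ hq0]
      congr 1
      linarith [two_mul_triangular (2 * j + 1)]
    rw [expand, zpow_add₀ hne, hsign, a1, show 2 * (n + -1 * j) + ε + (2 * j + 1)
      = 2 * n + (1 + ε) by ring]
    ring
  have split : ∀ n : ℤ, q ^ (n ^ 2 + ε * n) * x ^ (2 * n + ε) * qPoch (q ^ (n + 1) * x) q =
      ∑' j : ℤ, q ^ (n ^ 2 + ε * n) * x ^ (2 * n + ε) * eulerTerm q (q ^ (n + 1) * x) (2 * j) +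
      ∑' j : ℤ, q ^ (n ^ 2 + ε * n) * x ^ (2 * n + ε) *
        eulerTerm q (q ^ (n + 1) * x) (2 * j + 1) := fun n => by
    have hy : q ^ (n + 1) * x ≠ 0 := mul_ne_zero (zpow_ne_zero _ hq0) hx
    rw [← tsum_eulerTerm hq0 hq1 hy,
      tsum_int_eq_sum_tsum_mod 2 (summable_norm_eulerTerm hq0 hq1 hy).of_norm]
    simp [tsum_mul_left, mul_add]
  simp only [split]
  exact ⟨c0.add c1, by rw [c0.tsum_add c1, d0, d1]⟩

omit hq1 in
theorem canonicalTerm_two (x : ℂ) (k n : ℤ) :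
    canonicalTerm q x q 2 k n = q ^ (n ^ 2 + k * n) * x ^ (2 * n + k) := by
  rw [canonicalTerm, ← zpow_add₀ hq0]
  congr 2
  have := two_mul_triangular n
  rw [triangular] at this
  linarith

end

end

/-! ### Assembly of the matrix identity -/

theorem mainTheorem11 (τ z q x : ℂ) (hτ : 0 < τ.im)
    (hq : q = Complex.exp (2 * Real.pi * Complex.I * τ))
    (hx : x = Complex.exp (2 * Real.pi * Complex.I * z)) :
    (Summable fun n : ℤ => q ^ (n ^ 2) * x ^ (2 * n) * qPoch (q ^ (n + 1) * x) q) ∧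
    (Summable fun n : ℤ => q ^ (n ^ 2 + n) * x ^ (2 * n + 1) * qPoch (q ^ (n + 1) * x) q) ∧
    (Summable fun n : ℤ => canonicalTerm q x q 2 0 n) ∧
    (Summable fun n : ℤ => canonicalTerm q x q 2 1 n) ∧
    ![∑' n : ℤ, q ^ (n ^ 2) * x ^ (2 * n) * qPoch (q ^ (n + 1) * x) q,
      ∑' n : ℤ, q ^ (n ^ 2 + n) * x ^ (2 * n + 1) * qPoch (q ^ (n + 1) * x) q] =
      rogRamMatrix q *ᵥ ![canonicalVec q x q 2 0, canonicalVec q x q 2 1] := by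
  have hq0 : q ≠ 0 := hq ▸ Complex.exp_ne_zero _
  have hx0 : x ≠ 0 := hx ▸ Complex.exp_ne_zero _
  have hq1 : ‖q‖ < 1 := hq ▸ UpperHalfPlane.norm_exp_two_pi_I_lt_one ⟨τ, hτ⟩
  have sc : ∀ k : ℤ, Summable fun n : ℤ => canonicalTerm q x q 2 k n := fun k => by
    simp only [canonicalTerm_two hq0]
    exact (summable_norm_zpow_mul_zpow hq0 hq1 hx0 (A := 1) (B := k) (C := 0) one_pos
      (fun n => by push_cast; ring) 2 k).of_norm
  have vec : ∀ k : ℤ, ∑' n : ℤ, q ^ (n ^ 2 + k * n) * x ^ (2 * n + k) = canonicalVec q x q 2 k :=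
    fun k => by simp only [canonicalVec, canonicalTerm_two hq0]
  -- The odd part of the second row lands on index 2, which returns to index 0 by `n ↦ n - 1`.
  have vec2 : canonicalVec q x q 2 2 = q⁻¹ * canonicalVec q x q 2 0 := by
    rw [← vec, ← vec, ← tsum_mul_left, ← (Equiv.subRight (1 : ℤ)).tsum_eq]
    refine tsum_congr fun n => ?_
    rw [Equiv.subRight_apply, ← mul_assoc, ← _root_.zpow_neg_one, ← zpow_add₀ hq0]
    ring_nf
  obtain ⟨s0, t0⟩ := tsum_mul_qPoch_expansion hq0 hq1 hx0 0
  obtain ⟨s1, t1⟩ := tsum_mul_qPoch_expansion hq0 hq1 hx0 1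
  have even0 := tsum_even_one hq0 hq1
  have odd0 := tsum_odd_two hq0 hq1
  have even1 := tsum_even_zero hq0 hq1
  have odd1 := tsum_odd_one hq0 hq1
  -- The factor `q` split off the odd coefficients is the one in `B(q)`; in `C(q)` it cancels the
  -- `q⁻¹` from `vec2`.
  norm_num only [vec, zpow_add_one₀ hq0 (_ + _), neg_mul, tsum_neg] at t0 t1
  simp only [mul_right_comm _ q, tsum_mul_right] at t0 t1
  simp only [zero_mul, add_zero, one_mul] at s0 s1 t0 t1
  refine ⟨s0, s1, sc 0, sc 1, ?_⟩
  rw [t0, t1, vec2, even0, odd0, even1, odd1]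
  ext i
  fin_cases i
  · simp [rogRamMatrix, mulVec, dotProduct]
    ring
  · simp [rogRamMatrix, mulVec, dotProduct]
    field_simp
    ring
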